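/- Let $q$ be a prime power, let $s\ge 1$ be an integer, and let $Q=\{0,1,\dots,q-1\}^s$. For $x=(x_1,\dots,x_s)\in Q$ put $\deg x=x_1+\dots+x_s$ (a sum of integers), and write $x\preceq y$ if $x_i\le y_i$ for all $i$. For $A\subseteq Q$ let $$\nabla A=\{y\in Q:\ x\preceq y\text{ for some }x\in A\},\qquad \Delta A=\{y\in Q:\ y\preceq x\text{ for some }x\in A\}.$$ Let $\prec_{\mathrm{Lex}}$ be the lexicographic order on $Q$: $x\prec_{\mathrm{Lex}}y$ if for some $l$ one has $x_i=y_i$ for all $i<l$ and $x_l<y_l$. Let $\prec_{\mathrm A}$ be the anti lexicographic order on $Q$: $x\prec_{\mathrm A}y$ if for some $l$ one has $x_i=y_i$ for all $i>l$ and $x_l>y_l$. For integers $0\le a\le b\le s(q-1)$ let $F_q(a,b)=\{x\in Q:\ a\le\deg x\le b\}$, and for $m\le|F_q(a,b)|$ let $L_{(a,b)}(m)$ and $N_{(a,b)}(m)$ be the sets of the first $m$ elements of $F_q(a,b)$ with respect to $\prec_{\mathrm{Lex}}$ and $\prec_{\mathrm A}$, respectively. Then, for all such $a,b$ and every subset $A$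 of $F_q(a,b)$ with exactly $m$ elements, $$|\nabla N_{(a,b)}(m)|\le|\nabla A|\qquad\text{and}\qquad|\Delta L_{(a,b)}(m)|\le|\Delta A|.$$ -/

import Mathlib

namespace RMShadow

/-- The set `Q_q^s` of exponent vectors `(a_1, …, a_s)` with `0 ≤ a_i < q`. -/
abbrev Q (q s : ℕ) : Type := Fin s → Fin q

/-- The degree `a_1 + ⋯ + a_s` (a natural number, no reduction modulo `q`). -/
def deg {q s : ℕ} (x : Q q s) : ℕ := ∑ i, (x i : ℕ)

/-- The upward shadow of a vector: all vectors of `Q_q^s` that are componentwise `≥ x`. -/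
def upShadow {q s : ℕ} (x : Q q s) : Finset (Q q s) := {y : Q q s | ∀ i, x i ≤ y i}

/-- The lower shadow of a vector: all vectors of `Q_q^s` that are componentwise `≤ x`. -/
def lowShadow {q s : ℕ} (x : Q q s) : Finset (Q q s) := {y : Q q s | ∀ i, y i ≤ x i}

/-- The upward shadow of a set, the union of the upward shadows of its elements. -/
def nabla {q s : ℕ} (A : Finset (Q q s)) : Finset (Q q s) := A.biUnion upShadow

/-- The lower shadow of a set, the union of the lower shadows of its elements. -/
def delta {q s : ℕ} (A : Finset (Q q s)) : Finset (Q q s) := A.biUnion lowShadow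

/-- Strict lexicographic order: at the first coordinate where the vectors differ, `x` is smaller. -/
def LexLT {q s : ℕ} (x y : Q q s) : Prop :=
  ∃ l : Fin s, (∀ i : Fin s, i < l → x i = y i) ∧ x l < y l

/-- Strict anti lexicographic order: at the last coordinate where the vectors differ, `x` is
larger. -/
def AntiLexLT {q s : ℕ} (x y : Q q s) : Prop :=
  ∃ l : Fin s, (∀ i : Fin s, l < i → x i = y i) ∧ y l < x l

instance {q s : ℕ} (x y : Q q s) : Decidable (LexLT x y) := by
  unfold LexLT; infer_instance

instance {q s : ℕ} (x y : Q q s) : Decidable (AntiLexLT x y) := by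
  unfold AntiLexLT; infer_instance

/-- `LexLT` is the strict order of Mathlib's linear order on `Lex (Fin s → Fin q)`. -/
theorem lexLT_iff {q s : ℕ} (x y : Q q s) : LexLT x y ↔ toLex x < toLex y := Iff.rfl

/-- `F_q((a,b),s)`: the vectors of `Q_q^s` with degree between `a` and `b`, both included. -/
def F (q s a b : ℕ) : Finset (Q q s) := {x : Q q s | a ≤ deg x ∧ deg x ≤ b}

/-- `L_{(a,b)}(m)`: the first `m` elements of `F_q((a,b),s)` in the lexicographic order, that is,
those elements of it with fewer than `m` predecessors in it. -/
def L (q s a b m : ℕ) : Finset (Q q s) :=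
  {x ∈ F q s a b | ({y ∈ F q s a b | LexLT y x} : Finset (Q q s)).card < m}

/-- `N_{(a,b)}(m)`: the first `m` elements of `F_q((a,b),s)` in the anti lexicographic order, that
is, those elements of it with fewer than `m` predecessors in it. -/
def N (q s a b m : ℕ) : Finset (Q q s) :=
  {x ∈ F q s a b | ({y ∈ F q s a b | AntiLexLT y x} : Finset (Q q s)).card < m}

end RMShadow

/-! The core is the Clements–Lindström inequality: within one level of the grid, lexicographic
initial segments minimise the one-step lower shadow. It iterates to shadows at every lower degree,
because the shadow of an initial segment is again an initial segment (`IsSeg.shadowAt`).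

It is proved by induction on the dimension, with dimensions at most two done by hand. Replacing
every slice along a coordinate by an initial segment does not enlarge the shadow, so the set may be
taken compressed in all coordinates. In dimension at least three it is then closed under moving a
unit to the last coordinate, and `Shifted.card_bdry` computes its shadow from the first and last
slices alone; these are compared with those of a segment by `card_slice_le_of_lt`.

For a band of degrees, the lexicographic segment `X` gains nothing from its shadow in degrees at
least `a`, and below `a` its shadow comes from its part of degree `a`. It remains to bound that part
by the degree-`a` part of `delta A`, which `ClementsLindstrom.card_le_shadowAt` does. The upward
statement follows from the order-reversing bijection `flip`. -/

namespace RMShadow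

variable {q s : ℕ}

/-! ### Degrees and moves between levels -/

/-- The vectors of degree exactly `d`. -/
def level (q s d : ℕ) : Finset (Q q s) := {x | deg x = d}

open Classical in
/-- The one-step lower shadow. -/
noncomputable def bdry (A : Finset (Q q s)) : Finset (Q q s) := {y | ∃ x ∈ A, y ≤ x ∧ deg y + 1 = deg x}

open Classical in
/-- The part of the lower shadow in degree `k`. -/
noncomputable def shadowAt (k : ℕ) (A : Finset (Q q s)) : Finset (Q q s) := {y | deg y = k ∧ ∃ x ∈ A, y ≤ x}

/-- `I` is an initial segment of the level `d` for the lexicographic order. -/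
def IsSeg (d : ℕ) (I : Finset (Q q s)) : Prop :=
  I ⊆ level q s d ∧ ∀ x ∈ I, ∀ y ∈ level q s d, toLex y < toLex x → y ∈ I

@[simp] theorem mem_level {d : ℕ} {x : Q q s} : x ∈ level q s d ↔ deg x = d := by
  simp [level]

@[simp] theorem mem_bdry {A : Finset (Q q s)} {y : Q q s} :
    y ∈ bdry A ↔ ∃ x ∈ A, y ≤ x ∧ deg y + 1 = deg x := by
  simp [bdry]

@[simp] theorem mem_shadowAt {k : ℕ} {A : Finset (Q q s)} {y : Q q s} :
    y ∈ shadowAt k A ↔ deg y = k ∧ ∃ x ∈ A, y ≤ x := by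
  simp [shadowAt]

theorem deg_mono {x y : Q q s} (h : x ≤ y) : deg x ≤ deg y :=
  Finset.sum_le_sum fun i _ => h i

theorem eq_of_le_of_deg_le {x y : Q q s} (h : x ≤ y) (hd : deg y ≤ deg x) : x = y := by
  have h1 := (Finset.sum_eq_sum_iff_of_le (s := Finset.univ)
    (f := fun i => (x i : ℕ)) (g := fun i => (y i : ℕ)) (fun i _ => h i)).1
    (le_antisymm (deg_mono h) hd)
  funext i
  exact Fin.ext (h1 i (Finset.mem_univ i))

theorem exists_pred {x : Q q s} {i : Fin s} (hi : 0 < (x i : ℕ)) :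
    ∃ y : Q q s, (y i : ℕ) + 1 = x i ∧ (∀ j, j ≠ i → y j = x j) ∧ y ≤ x ∧
      deg y + 1 = deg x := by
  have hne : ∀ j, j ≠ i →
      Function.update x i ⟨(x i : ℕ) - 1, by omega⟩ j = x j := fun j hj => by simp [hj]
  refine ⟨Function.update x i ⟨(x i : ℕ) - 1, by omega⟩, ?_, hne, ?_, ?_⟩
  · simp; omega
  · intro j
    by_cases hj : j = i
    · subst hj; simp [Fin.le_def]
    · rw [hne j hj]
  · unfold deg
    rw [← Finset.add_sum_erase _ _ (Finset.mem_univ i),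
      ← Finset.add_sum_erase _ (fun j => (x j : ℕ)) (Finset.mem_univ i),
      Finset.sum_congr rfl fun j hj => by rw [hne j (Finset.ne_of_mem_erase hj)]]
    simp; omega

theorem exists_between {x y : Q q s} (h : y ≤ x) {k : ℕ} (h1 : deg y ≤ k) (h2 : k ≤ deg x) :
    ∃ z, y ≤ z ∧ z ≤ x ∧ deg z = k := by
  induction hn : deg x - k generalizing x with
  | zero => exact ⟨x, h, le_rfl, by omega⟩
  | succ n ih =>
    obtain ⟨i, hi⟩ : ∃ i, y i < x i := by
      by_contra! hc
      have : deg x ≤ deg y := deg_mono hc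
      omega
    obtain ⟨x', hx1, hx2, hx3, hx4⟩ := exists_pred (x := x) (i := i) (by
      have := Fin.lt_def.1 hi; omega)
    obtain ⟨z, hz1, hz2, hz3⟩ := ih (x := x') (fun j => by
      by_cases hj : j = i
      · subst hj; have := Fin.lt_def.1 hi; rw [Fin.le_def]; omega
      · rw [hx2 j hj]; exact h j) (by omega) (by omega)
    exact ⟨z, hz1, hz2.trans hx3, hz3⟩

/-- A vector of larger degree which is lexicographically larger can be lowered to the degree of
the smaller one without falling below it. -/
theorem exists_le_of_lex_le {u h : Q q s} (hl : toLex u ≤ toLex h) (hd : deg u ≤ deg h) :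
    ∃ y ≤ h, deg y = deg u ∧ toLex u ≤ toLex y := by
  induction hn : deg h - deg u generalizing h with
  | zero => exact ⟨h, le_rfl, by omega, hl⟩
  | succ n ih =>
    have hlt : toLex u < toLex h := lt_of_le_of_ne hl (by
      rintro he
      have : u = h := he
      subst this; omega)
    obtain ⟨l, hl1, hl2⟩ : LexLT u h := hlt
    have hl2' := Fin.lt_def.1 hl2
    have hne : (Finset.univ.filter fun i => 0 < (h i : ℕ)).Nonempty := ⟨l, by simp; omega⟩
    -- Lowering the last nonzero coordinate disturbs the order least. If it is also the coordinate
    -- `l` where `h` first exceeds `u`, then `h` vanishes beyond it, and either `h'` still exceeds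
    -- `u` at `l` or `h' ≤ u`, when degrees force `h' = u`.
    set i := Finset.max' _ hne with hidef
    have hi0 : 0 < (h i : ℕ) := by simpa using Finset.max'_mem _ hne
    have himax : ∀ j, 0 < (h j : ℕ) → j ≤ i := fun j hj =>
      Finset.le_max' _ _ (by simpa using hj)
    obtain ⟨h', h1, h2, h3, h4⟩ := exists_pred hi0
    have hli : l ≤ i := himax l (by omega)
    have key : toLex u ≤ toLex h' := by
      rcases hli.lt_or_eq with hlt | heq
      · refine le_of_lt (show LexLT u h' from ⟨l, fun j hj => ?_, ?_⟩)
        · rw [h2 j (by rintro rfl; exact absurd hj hlt.le.not_gt), hl1 j hj]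
        · rw [h2 l hlt.ne]; exact hl2
      · rw [← heq] at h1 h2
        by_cases hc : u l < h' l
        · refine le_of_lt (show LexLT u h' from ⟨l, fun j hj => ?_, hc⟩)
          rw [h2 j hj.ne, hl1 j hj]
        · have hc' := Fin.lt_def.not.1 hc
          have : h' = u := eq_of_le_of_deg_le (fun j => by
            rcases lt_trichotomy j l with hj | hj | hj
            · rw [h2 j hj.ne, hl1 j hj]
            · subst hj; rw [Fin.le_def]; omega
            · rw [h2 j hj.ne', Fin.le_def]
              have : ¬ 0 < (h j : ℕ) := fun h0 => absurd (himax j h0) (by rw [← heq]; exact hj.not_ge)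
              omega) (by omega)
          rw [this]
    obtain ⟨y, hy1, hy2, hy3⟩ := ih key (by omega) (by omega)
    exact ⟨y, hy1.trans h3, hy2, hy3⟩

/-- The coordinatewise complement. -/
def compl (x : Q q s) : Q q s := fun i => (x i).rev

@[simp] theorem compl_compl (x : Q q s) : compl (compl x) = x := by
  funext i; simp [compl]

theorem compl_le_compl {x y : Q q s} : compl x ≤ compl y ↔ y ≤ x := by
  simp [compl, Pi.le_def]

theorem deg_compl (x : Q q s) : deg (compl x) + deg x = s * (q - 1) := by
  unfold deg compl
  rw [← Finset.sum_add_distrib, Finset.sum_congr rfl (g := fun _ => q - 1)]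
  · simp
  · intro i _
    have := (x i).2
    rw [Fin.val_rev]; omega

theorem lexLT_compl {x y : Q q s} (h : LexLT x y) : LexLT (compl y) (compl x) := by
  obtain ⟨l, h1, h2⟩ := h
  exact ⟨l, fun i hi => by simp [compl, h1 i hi], by simpa [compl] using h2⟩

theorem toLex_compl_le {x y : Q q s} (h : toLex x ≤ toLex y) :
    toLex (compl y) ≤ toLex (compl x) := by
  rcases h.lt_or_eq with h | h
  · exact le_of_lt (lexLT_compl h)
  · have : x = y := h
    rw [this]

/-- Dual of `exists_le_of_lex_le`, since complementation reverses both orders. -/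
theorem exists_ge_of_lex_le {u h : Q q s} (hl : toLex u ≤ toLex h) (hd : deg u ≤ deg h) :
    ∃ y, u ≤ y ∧ deg y = deg h ∧ toLex y ≤ toLex h := by
  have e1 := deg_compl u
  have e2 := deg_compl h
  obtain ⟨y, h1, h2, h3⟩ := exists_le_of_lex_le (toLex_compl_le hl) (by omega)
  have e3 := deg_compl y
  refine ⟨compl y, ?_, by omega, ?_⟩
  · rw [← compl_le_compl, compl_compl]; exact h1
  · have := toLex_compl_le h3
    rwa [compl_compl] at this

/-! ### Shadows and initial segments of a level -/

theorem bdry_mono {A B : Finset (Q q s)} (h : A ⊆ B) : bdry A ⊆ bdry B := by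
  intro y; simp only [mem_bdry]
  rintro ⟨x, hx, hy⟩; exact ⟨x, h hx, hy⟩

theorem shadowAt_subset_level {k : ℕ} {A : Finset (Q q s)} : shadowAt k A ⊆ level q s k := by
  intro y; simp only [mem_shadowAt, mem_level]; exact fun h => h.1

theorem shadowAt_self {d : ℕ} {A : Finset (Q q s)} (hA : A ⊆ level q s d) :
    shadowAt d A = A := by
  ext y
  rw [mem_shadowAt]
  constructor
  · rintro ⟨h1, x, hx, hyx⟩
    have := mem_level.1 (hA hx)
    rwa [eq_of_le_of_deg_le hyx (by omega)]
  · exact fun h => ⟨mem_level.1 (hA h), y, h, le_rfl⟩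

theorem bdry_shadowAt {d k : ℕ} {A : Finset (Q q s)} (hA : A ⊆ level q s d) (hk : k < d) :
    bdry (shadowAt (k + 1) A) = shadowAt k A := by
  ext y
  simp only [mem_bdry, mem_shadowAt]
  constructor
  · rintro ⟨x, ⟨h1, z, hz, hxz⟩, hyx, h2⟩
    exact ⟨by omega, z, hz, hyx.trans hxz⟩
  · rintro ⟨h1, x, hx, hyx⟩
    have := mem_level.1 (hA hx)
    obtain ⟨z, hz1, hz2, hz3⟩ := exists_between hyx (k := k + 1) (by omega) (by omega)
    exact ⟨z, ⟨hz3, x, hx, hz2⟩, hz1, by omega⟩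

theorem bdry_eq_shadowAt {d : ℕ} {A : Finset (Q q s)} (hA : A ⊆ level q s (d + 1)) :
    bdry A = shadowAt d A := by
  rw [← bdry_shadowAt hA (Nat.lt_succ_self d), shadowAt_self hA]

theorem bdry_eq_empty {A : Finset (Q q s)} (hA : A ⊆ level q s 0) : bdry A = ∅ := by
  ext y
  simp only [mem_bdry, Finset.notMem_empty, iff_false]
  rintro ⟨x, hx, -, h⟩
  have := mem_level.1 (hA hx)
  omega

theorem IsSeg.mem_of_le {d : ℕ} {I : Finset (Q q s)} (hI : IsSeg d I) {x y : Q q s}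
    (hx : x ∈ I) (hy : deg y = d) (h : toLex y ≤ toLex x) : y ∈ I := by
  rcases h.lt_or_eq with h | h
  · exact hI.2 x hx y (mem_level.2 hy) h
  · have : y = x := h
    rwa [this]

/-- If `z` precedes some `y ≤ x` with `x ∈ I`, then `z` can be raised to degree `d` without passing
`x`, hence inside `I`. -/
theorem IsSeg.shadowAt {d k : ℕ} {I : Finset (Q q s)} (hI : IsSeg d I) (hk : k ≤ d) :
    IsSeg k (shadowAt k I) := by
  refine ⟨shadowAt_subset_level, fun y hy z hz hlt => ?_⟩
  obtain ⟨hy1, x, hx, hyx⟩ := mem_shadowAt.1 hy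
  have hd := mem_level.1 (hI.1 hx)
  have hz := mem_level.1 hz
  obtain ⟨w, hw1, hw2, hw3⟩ := exists_ge_of_lex_le (hlt.le.trans (Pi.toLex_monotone hyx))
    (by omega)
  exact mem_shadowAt.2 ⟨hz, w, hI.mem_of_le hx (by omega) hw3, hw1⟩

theorem IsSeg.bdry {d : ℕ} {I : Finset (Q q s)} (hI : IsSeg d I) : IsSeg (d - 1) (bdry I) := by
  cases d with
  | zero => rw [bdry_eq_empty hI.1]; exact ⟨by simp, by simp⟩
  | succ d => rw [bdry_eq_shadowAt hI.1]; exact hI.shadowAt (Nat.le_succ d)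

theorem IsSeg.subset_of_card_le {d : ℕ} {I J : Finset (Q q s)} (hI : IsSeg d I) (hJ : IsSeg d J)
    (h : I.card ≤ J.card) : I ⊆ J := by
  by_contra hc
  obtain ⟨x, hxI, hxJ⟩ := Finset.not_subset.1 hc
  have hJI : J ⊆ I := fun y hy => by
    rcases le_total (toLex y) (toLex x) with h | h
    · exact hI.mem_of_le hxI (mem_level.1 (hJ.1 hy)) h
    · exact absurd (hJ.mem_of_le hy (mem_level.1 (hI.1 hxI)) h) hxJ
  exact hc (Finset.eq_of_subset_of_card_le hJI h).ge

/-- The number of elements of rank less than `m` of a finite set in a strict total order. -/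
theorem card_filter_rank_lt {α : Type*} [DecidableEq α] (r : α → α → Prop) [DecidableRel r]
    (hirr : ∀ x, ¬ r x x) (htrans : ∀ x y z, r x y → r y z → r x z)
    (htri : ∀ x y, r x y ∨ x = y ∨ r y x) (S : Finset α) (m : ℕ) :
    (S.filter fun x => (S.filter fun y => r y x).card < m).card = min m S.card := by
  have hmono : ∀ x ∈ S, ∀ y ∈ S, r x y →
      (S.filter fun z => r z x).card < (S.filter fun z => r z y).card := by
    intro x hx y hy hxy
    refine Finset.card_lt_card ⟨fun z hz => ?_, fun hc => ?_⟩
    · rw [Finset.mem_filter] at hz ⊢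
      exact ⟨hz.1, htrans _ _ _ hz.2 hxy⟩
    · exact hirr x (Finset.mem_filter.1 (hc (Finset.mem_filter.2 ⟨hx, hxy⟩))).2
  have hinj : Set.InjOn (fun x => (S.filter fun y => r y x).card) (S : Set α) := by
    intro x hx y hy hxy
    rcases htri x y with h | h | h
    · exact absurd hxy (hmono x hx y hy h).ne
    · exact h
    · exact absurd hxy (hmono y hy x hx h).ne'
  have himg : S.image (fun x => (S.filter fun y => r y x).card) = Finset.range S.card := by
    refine Finset.eq_of_subset_of_card_le (fun n hn => ?_) ?_
    · obtain ⟨x, hx, rfl⟩ := Finset.mem_image.1 hn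
      rw [Finset.mem_range]
      exact Finset.card_lt_card (Finset.filter_ssubset.2 ⟨x, hx, hirr x⟩)
    · rw [Finset.card_image_of_injOn hinj, Finset.card_range]
  rw [← Finset.card_image_of_injOn
    (hinj.mono (Finset.coe_subset.2 (Finset.filter_subset _ _))),
    ← Finset.card_range (min m S.card)]
  congr 1
  ext n
  simp only [Finset.mem_image, Finset.mem_filter, Finset.mem_range, lt_min_iff]
  constructor
  · rintro ⟨x, ⟨hx, h⟩, rfl⟩
    exact ⟨h, Finset.mem_range.1 (himg ▸ Finset.mem_image_of_mem _ hx)⟩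
  · rintro ⟨h1, h2⟩
    obtain ⟨x, hx, rfl⟩ := Finset.mem_image.1 (himg ▸ Finset.mem_range.2 h2)
    exact ⟨x, ⟨hx, h1⟩, rfl⟩

theorem card_L (a b m : ℕ) : (L q s a b m).card = min m (F q s a b).card :=
  card_filter_rank_lt (LexLT : Q q s → Q q s → Prop) (fun x => lt_irrefl (toLex x))
    (fun x y z => lt_trans (a := toLex x) (b := toLex y) (c := toLex z))
    (fun x y => lt_trichotomy (toLex x) (toLex y)) (F q s a b) m

theorem mem_L_of_lex_le {a b m : ℕ} {x y : Q q s} (hx : x ∈ L q s a b m) (hy : y ∈ F q s a b)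
    (h : toLex y ≤ toLex x) : y ∈ L q s a b m := by
  unfold L at hx ⊢
  rw [Finset.mem_filter] at hx ⊢
  refine ⟨hy, lt_of_le_of_lt (Finset.card_le_card fun z hz => ?_) hx.2⟩
  rw [Finset.mem_filter] at hz ⊢
  exact ⟨hz.1, lt_of_lt_of_le (show toLex z < toLex y from hz.2) h⟩

theorem exists_isSeg {d m : ℕ} (hm : m ≤ (level q s d).card) :
    ∃ I : Finset (Q q s), IsSeg d I ∧ I.card = m := by
  have hF : F q s d d = level q s d := by
    ext x; simp only [F, Finset.mem_filter, Finset.mem_univ, true_and, mem_level]; omega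
  refine ⟨L q s d d m, ⟨fun x hx => ?_, fun x hx y hy h => ?_⟩, ?_⟩
  · rw [← hF]; exact (Finset.mem_filter.1 hx).1
  · exact mem_L_of_lex_le hx (hF ▸ hy) h.le
  · rw [card_L, hF]; omega

/-! ### The inequality on one level and its iteration -/

/-- The Clements–Lindström inequality for the grid of dimension `s`. -/
def ClementsLindstrom (q s : ℕ) : Prop :=
  ∀ (d : ℕ) (A I : Finset (Q q s)), A ⊆ level q s d → IsSeg d I → I.card ≤ A.card →
    (bdry I).card ≤ (bdry A).card

theorem clementsLindstrom_of_card_eq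
    (h : ∀ (d : ℕ) (A I : Finset (Q q s)), A ⊆ level q s d → IsSeg d I → I.card = A.card →
      (bdry I).card ≤ (bdry A).card) : ClementsLindstrom q s := by
  intro d A I hA hI hc
  obtain ⟨B, hB, hBc⟩ := Finset.exists_subset_card_eq hc
  exact (h d B I (hB.trans hA) hI hBc.symm).trans (Finset.card_le_card (bdry_mono hB))

theorem ClementsLindstrom.shadowAt (H : ClementsLindstrom q s) {d k : ℕ} (hk : k ≤ d)
    {A I : Finset (Q q s)} (hA : A ⊆ level q s d) (hI : IsSeg d I) (hc : I.card ≤ A.card) :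
    (shadowAt k I).card ≤ (shadowAt k A).card := by
  induction hk using Nat.decreasingInduction with
  | self => rwa [shadowAt_self hA, shadowAt_self hI.1]
  | of_succ k hk ih =>
    rw [← bdry_shadowAt hA hk, ← bdry_shadowAt hI.1 hk]
    exact H (k + 1) _ _ shadowAt_subset_level (hI.shadowAt hk) ih

/-- If a set `B` of degree `e` is larger than the initial segment `J`, and some vectors `K` of lower
degree `k` precede everything of degree `e` outside `J`, then the shadow of `B` is larger than
`K`. -/
theorem ClementsLindstrom.card_le_shadowAt (H : ClementsLindstrom q s) {e k : ℕ} (hk : k ≤ e)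
    {B J K : Finset (Q q s)} (hB : B ⊆ level q s e) (hc : J.card < B.card)
    (hK : K ⊆ level q s k)
    (hJK : ∀ h ∈ level q s e, h ∉ J → ∀ u ∈ K, toLex u ≤ toLex h) :
    K.card ≤ (RMShadow.shadowAt k B).card := by
  -- The segment of the size of `B` has an element `h` outside `J`. Each `u ∈ K` precedes or equals
  -- some vector of degree `k` below `h`, so it lies in the shadow of `I`, which is a segment.
  obtain ⟨I, hI, hIc⟩ := exists_isSeg (Finset.card_le_card hB)
  obtain ⟨h, hhI, hhJ⟩ := Finset.exists_mem_notMem_of_card_lt_card (hc.trans_eq hIc.symm)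
  have hd := mem_level.1 (hI.1 hhI)
  refine (Finset.card_le_card fun u hu => ?_).trans (H.shadowAt hk hB hI hIc.le)
  have hud := mem_level.1 (hK hu)
  obtain ⟨y, hy1, hy2, hy3⟩ := exists_le_of_lex_le (hJK h (hI.1 hhI) hhJ u hu) (by omega)
  exact (hI.shadowAt hk).mem_of_le (mem_shadowAt.2 ⟨by omega, h, hhI, hy1⟩) hud hy3

/-- In dimension at most one, each level has at most one element. -/
theorem clementsLindstrom_of_le_one (hs : s ≤ 1) : ClementsLindstrom q s := by
  refine clementsLindstrom_of_card_eq fun d A I hA hI hc => ?_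
  have hsub : ∀ x y : Q q s, deg x = deg y → x = y := by
    intro x y h
    funext i
    have : Subsingleton (Fin s) := Fin.subsingleton_iff_le_one.2 hs
    unfold deg at h
    rw [Fintype.sum_subsingleton _ i, Fintype.sum_subsingleton _ i] at h
    exact Fin.ext h
  have : I = A := by
    rcases A.eq_empty_or_nonempty with rfl | ⟨a, ha⟩
    · simpa using hc
    · obtain ⟨b, hb⟩ : I.Nonempty := Finset.card_pos.1 (hc ▸ Finset.card_pos.2 ⟨a, ha⟩)
      refine Finset.eq_of_subset_of_card_le (fun x hx => ?_) hc.ge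
      rw [hsub x a (by rw [mem_level.1 (hI.1 hx), mem_level.1 (hA ha)])]
      exact ha
  rw [this]

/-! ### Dimension two -/

/-- First coordinates of the one-step shadow of a plane set of degree `d` with first coordinates
`U`. -/
def planeShadow (d : ℕ) (U : Finset ℕ) : Finset ℕ :=
  U.filter (· < d) ∪ (U.filter (0 < ·)).image (· - 1)

theorem mem_planeShadow {d n : ℕ} {U : Finset ℕ} :
    n ∈ planeShadow d U ↔ (n ∈ U ∧ n < d) ∨ n + 1 ∈ U := by
  simp only [planeShadow, Finset.mem_union, Finset.mem_filter, Finset.mem_image]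
  refine or_congr Iff.rfl ⟨?_, fun h => ⟨n + 1, ⟨h, by omega⟩, rfl⟩⟩
  rintro ⟨a, ⟨h1, h2⟩, rfl⟩
  rwa [Nat.sub_add_cancel h2]

/-- If `lo = 0`, the shadow of a segment stays inside it, while a set missing some `w` embeds in its
shadow by decrementing the elements above `w`. If `lo > 0`, every nonempty set gains the point below
its minimum, and a segment gains at most `lo - 1`. -/
theorem card_planeShadow_le {d lo hi : ℕ} (h : lo = 0 ∧ hi = d ∨ 0 < lo ∧ hi < d)
    {U V : Finset ℕ} (hU : U ⊆ Finset.Icc lo hi) (hV : V ⊆ Finset.Icc lo hi)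
    (hseg : ∀ n ∈ V, ∀ k, lo ≤ k → k < n → k ∈ V) (hc : V.card = U.card) :
    (planeShadow d V).card ≤ (planeShadow d U).card := by
  rcases h with ⟨rfl, rfl⟩ | ⟨hlo, hhi⟩
  · by_cases hfull : U = Finset.Icc 0 hi
    · subst hfull
      rw [Finset.eq_of_subset_of_card_le hV hc.ge]
    · obtain ⟨w, hw, hwU⟩ := Finset.exists_of_ssubset (hU.ssubset_of_ne hfull)
      rw [Finset.mem_Icc] at hw
      calc (planeShadow hi V).card ≤ V.card := Finset.card_le_card fun n hn => by
            rcases mem_planeShadow.1 hn with h | h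
            · exact h.1
            · exact hseg _ h _ (Nat.zero_le _) (Nat.lt_succ_self _)
        _ = U.card := hc
        _ ≤ (planeShadow hi U).card := by
          refine Finset.card_le_card_of_injOn (fun n => if n < w then n else n - 1) ?_ ?_
          · intro n hn
            have hn' : n ∈ U := hn
            have hnw : n ≠ w := fun h => hwU (h ▸ hn')
            simp only [Finset.mem_coe]
            rw [mem_planeShadow]
            split_ifs with h
            · exact Or.inl ⟨hn', by omega⟩
            · right; rwa [Nat.sub_add_cancel (by omega)]
          · intro n hn m hm hnm
            have hnw : n ≠ w := fun h => hwU (h ▸ hn)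
            have hmw : m ≠ w := fun h => hwU (h ▸ hm)
            simp only at hnm
            split_ifs at hnm <;> omega
  · rcases U.eq_empty_or_nonempty with rfl | hne
    · have : V = ∅ := by simpa using hc
      rw [this]
    · set u := U.min' hne
      have huU : u ∈ U := Finset.min'_mem _ _
      have hu := Finset.mem_Icc.1 (hU huU)
      have hnot : u - 1 ∉ U := fun h => by
        have := Finset.min'_le U _ h
        omega
      calc (planeShadow d V).card ≤ (insert (lo - 1) V).card :=
            Finset.card_le_card fun n hn => by
              rw [Finset.mem_insert]
              rcases mem_planeShadow.1 hn with h | h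
              · exact Or.inr h.1
              · by_cases hl : lo ≤ n
                · exact Or.inr (hseg _ h _ hl (Nat.lt_succ_self _))
                · have := Finset.mem_Icc.1 (hV h)
                  left; omega
        _ ≤ V.card + 1 := Finset.card_insert_le _ _
        _ = (insert (u - 1) U).card := by rw [Finset.card_insert_of_notMem hnot, hc]
        _ ≤ (planeShadow d U).card := Finset.card_le_card fun n hn => by
          rw [mem_planeShadow]
          rcases Finset.mem_insert.1 hn with rfl | h
          · right; rwa [Nat.sub_add_cancel (by omega)]
          · left; exact ⟨h, by have := Finset.mem_Icc.1 (hU h); omega⟩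

theorem deg_two (x : Q q 2) : deg x = x 0 + x 1 := by
  simp [deg, Fin.sum_univ_two]

theorem eq_of_deg_two {x y : Q q 2} (h : (x 0 : ℕ) = y 0) (hd : deg x = deg y) : x = y := by
  rw [deg_two, deg_two] at hd
  funext i
  apply Fin.ext
  fin_cases i
  · exact h
  · simp only [Fin.mk_one]; omega

theorem card_image_fst {d : ℕ} {A : Finset (Q q 2)} (hA : A ⊆ level q 2 d) :
    (A.image fun x => (x 0 : ℕ)).card = A.card :=
  Finset.card_image_of_injOn fun x hx y hy h =>
    eq_of_deg_two h (by rw [mem_level.1 (hA hx), mem_level.1 (hA hy)])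

theorem image_fst_bdry {d : ℕ} {A : Finset (Q q 2)} (hA : A ⊆ level q 2 d) :
    (bdry A).image (fun x => (x 0 : ℕ)) = planeShadow d (A.image fun x => (x 0 : ℕ)) := by
  ext n
  rw [mem_planeShadow]
  simp only [Finset.mem_image, mem_bdry]
  constructor
  · rintro ⟨y, ⟨x, hx, hyx, hd⟩, rfl⟩
    have hxd := mem_level.1 (hA hx)
    have h0 := Fin.le_def.1 (hyx 0)
    have h1 := Fin.le_def.1 (hyx 1)
    rw [deg_two] at hxd
    rw [deg_two, deg_two] at hd
    by_cases h : (y 0 : ℕ) = x 0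
    · left; exact ⟨⟨x, hx, h.symm⟩, by omega⟩
    · right; exact ⟨x, hx, by omega⟩
  · rintro (⟨⟨x, hx, rfl⟩, hlt⟩ | ⟨x, hx, h⟩)
    · have hxd := mem_level.1 (hA hx)
      rw [deg_two] at hxd
      obtain ⟨y, h1, h2, h3, h4⟩ := exists_pred (x := x) (i := 1) (by omega)
      exact ⟨y, ⟨x, hx, h3, h4⟩, by rw [h2 0 (by simp)]⟩
    · obtain ⟨y, h1, h2, h3, h4⟩ := exists_pred (x := x) (i := 0) (by omega)
      exact ⟨y, ⟨x, hx, h3, h4⟩, by omega⟩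

theorem bdry_subset_level {d : ℕ} {A : Finset (Q q s)} (hA : A ⊆ level q s d) :
    bdry A ⊆ level q s (d - 1) := by
  intro y hy
  obtain ⟨x, hx, -, h⟩ := mem_bdry.1 hy
  have := mem_level.1 (hA hx)
  rw [mem_level]; omega

theorem clementsLindstrom_two : ClementsLindstrom q 2 := by
  refine clementsLindstrom_of_card_eq fun d A I hA hI hc => ?_
  rw [← card_image_fst (bdry_subset_level hA), ← card_image_fst (bdry_subset_level hI.1),
    image_fst_bdry hA, image_fst_bdry hI.1]
  -- Both coordinates are at most `q - 1` and add up to `d`. The cases `d ≤ q - 1` and `d > q - 1`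
  -- are the two alternatives of `card_planeShadow_le`.
  have hIcc : ∀ {B : Finset (Q q 2)}, B ⊆ level q 2 d →
      (B.image fun x => (x 0 : ℕ)) ⊆ Finset.Icc (d - (q - 1)) (min d (q - 1)) := by
    intro B hB n hn
    obtain ⟨x, hx, rfl⟩ := Finset.mem_image.1 hn
    have h := mem_level.1 (hB hx)
    have h0 := (x 0).2
    have h1 := (x 1).2
    rw [deg_two] at h
    rw [Finset.mem_Icc]; omega
  refine card_planeShadow_le (by omega) (hIcc hA) (hIcc hI.1) ?_
    (by rw [card_image_fst hA, card_image_fst hI.1, hc])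
  intro n hn k hk hkn
  obtain ⟨x, hx, rfl⟩ := Finset.mem_image.1 hn
  have h := mem_level.1 (hI.1 hx)
  have h0 := (x 0).2
  have h1 := (x 1).2
  rw [deg_two] at h
  refine Finset.mem_image.2 ⟨![⟨k, by omega⟩, ⟨d - k, by omega⟩], ?_, rfl⟩
  refine hI.2 x hx _ (by simp [deg_two]; omega) ?_
  exact show LexLT _ _ from ⟨0, fun i hi => absurd hi (by simp), hkn⟩

/-! ### Slices along a coordinate -/

/-- The vectors of `A` whose `j`-th coordinate is `c`, with this coordinate removed. -/
def slice (j : Fin (s + 1)) (c : ℕ) (A : Finset (Q q (s + 1))) : Finset (Q q s) :=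
  (A.filter fun x => (x j : ℕ) = c).image fun x => j.removeNth x

theorem mem_slice {j : Fin (s + 1)} {c : ℕ} {A : Finset (Q q (s + 1))} {h : Q q s} :
    h ∈ slice j c A ↔ ∃ x ∈ A, (x j : ℕ) = c ∧ j.removeNth x = h := by
  simp [slice, and_assoc]

theorem eq_of_removeNth_eq {j : Fin (s + 1)} {x y : Q q (s + 1)} (h : (x j : ℕ) = y j)
    (hr : j.removeNth x = j.removeNth y) : x = y := by
  rw [← Fin.insertNth_self_removeNth j x, ← Fin.insertNth_self_removeNth j y, hr, Fin.ext h]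

theorem removeNth_mem_slice {j : Fin (s + 1)} {A : Finset (Q q (s + 1))} {x : Q q (s + 1)} :
    j.removeNth x ∈ slice j (x j) A ↔ x ∈ A := by
  rw [mem_slice]
  constructor
  · rintro ⟨y, hy, h1, h2⟩
    rwa [← eq_of_removeNth_eq h1 h2]
  · exact fun h => ⟨x, h, rfl, rfl⟩

theorem exists_removeNth_eq (j : Fin (s + 1)) {c : ℕ} (hc : c < q) (h : Q q s) :
    ∃ x : Q q (s + 1), (x j : ℕ) = c ∧ j.removeNth x = h :=
  ⟨j.insertNth (α := fun _ => Fin q) ⟨c, hc⟩ h, by simp, by simp⟩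

theorem deg_removeNth (j : Fin (s + 1)) (x : Q q (s + 1)) :
    x j + deg (j.removeNth x) = deg x := by
  unfold deg
  rw [Fin.sum_univ_succAbove _ j]
  rfl

theorem le_iff_removeNth (j : Fin (s + 1)) {x y : Q q (s + 1)} :
    x ≤ y ↔ x j ≤ y j ∧ j.removeNth x ≤ j.removeNth y :=
  Fin.forall_iff_succAbove j

theorem toLex_lt_of_removeNth {j : Fin (s + 1)} {x y : Q q (s + 1)} (h : x j = y j)
    (hr : toLex (j.removeNth x) < toLex (j.removeNth y)) : toLex x < toLex y := by
  obtain ⟨l, h1, h2⟩ : LexLT _ _ := hr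
  refine show LexLT x y from ⟨j.succAbove l, fun i hi => ?_, h2⟩
  rcases Fin.eq_self_or_eq_succAbove j i with rfl | ⟨k, rfl⟩
  · exact h
  · exact h1 k ((Fin.strictMono_succAbove j).lt_iff_lt.1 hi)

/-- The last coordinate is compared last, so here nothing is required of it; slices at different
heights can thus be compared. -/
theorem toLex_lt_of_removeNth_last {x y : Q q (s + 1)}
    (hr : toLex ((Fin.last s).removeNth x) < toLex ((Fin.last s).removeNth y)) :
    toLex x < toLex y := by
  obtain ⟨l, h1, h2⟩ : LexLT _ _ := hr
  refine show LexLT x y from ⟨(Fin.last s).succAbove l, fun i hi => ?_, h2⟩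
  rcases Fin.eq_self_or_eq_succAbove (Fin.last s) i with rfl | ⟨k, rfl⟩
  · exact absurd (Fin.le_last _) hi.not_ge
  · exact h1 k ((Fin.strictMono_succAbove _).lt_iff_lt.1 hi)

/-- The lowered coordinate is either another one, staying in the slice, or `j` itself, coming from
the slice above. -/
theorem slice_bdry (j : Fin (s + 1)) (c : ℕ) (A : Finset (Q q (s + 1))) :
    slice j c (bdry A) = bdry (slice j c A) ∪ slice j (c + 1) A := by
  ext g
  rw [Finset.mem_union, mem_slice, mem_bdry, mem_slice]
  constructor
  · rintro ⟨y, hy, rfl, rfl⟩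
    obtain ⟨x, hx, hyx, hd⟩ := mem_bdry.1 hy
    obtain ⟨h1, h2⟩ := (le_iff_removeNth j).1 hyx
    have e1 := deg_removeNth j x
    have e2 := deg_removeNth j y
    have h3 := deg_mono h2
    rw [Fin.le_def] at h1
    by_cases h : (x j : ℕ) = y j
    · left; exact ⟨_, mem_slice.2 ⟨x, hx, h, rfl⟩, h2, by omega⟩
    · right; exact ⟨x, hx, by omega, (eq_of_le_of_deg_le h2 (by omega)).symm⟩
  · rintro (⟨h, hh, hgh, hd⟩ | ⟨x, hx, hc, rfl⟩)
    · obtain ⟨x, hx, rfl, rfl⟩ := mem_slice.1 hh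
      obtain ⟨y, hy1, rfl⟩ := exists_removeNth_eq j (x j).2 g
      have e1 := deg_removeNth j x
      have e2 := deg_removeNth j y
      exact ⟨y, mem_bdry.2 ⟨x, hx, (le_iff_removeNth j).2 ⟨Fin.le_def.2 hy1.le, hgh⟩, by omega⟩,
        hy1, rfl⟩
    · obtain ⟨y, hy1, hy2⟩ := exists_removeNth_eq j (c := c) (by have := (x j).2; omega)
        (j.removeNth x)
      have e1 := deg_removeNth j x
      have e2 := deg_removeNth j y
      rw [hy2] at e2
      exact ⟨y, mem_bdry.2 ⟨x, hx, (le_iff_removeNth j).2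
        ⟨Fin.le_def.2 (by omega), hy2.le⟩, by omega⟩, hy1, hy2⟩

theorem sum_eq_sum_slice (j : Fin (s + 1)) (A : Finset (Q q (s + 1))) (f : ℕ → Q q s → ℕ) :
    ∑ x ∈ A, f (x j) (j.removeNth x) = ∑ c ∈ Finset.range q, ∑ h ∈ slice j c A, f c h := by
  rw [← Finset.sum_fiberwise_of_maps_to (g := fun x : Q q (s + 1) => (x j : ℕ))
    (t := Finset.range q) (fun x _ => Finset.mem_range.2 (x j).2)]
  refine Finset.sum_congr rfl fun c _ => ?_
  unfold slice
  rw [Finset.sum_image]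
  · exact Finset.sum_congr rfl fun x hx => by rw [(Finset.mem_filter.1 hx).2]
  · intro x hx y hy h
    exact eq_of_removeNth_eq ((Finset.mem_filter.1 hx).2.trans (Finset.mem_filter.1 hy).2.symm) h

theorem card_eq_sum_slice (j : Fin (s + 1)) (A : Finset (Q q (s + 1))) :
    A.card = ∑ c ∈ Finset.range q, (slice j c A).card := by
  have := sum_eq_sum_slice j A fun _ _ => 1
  simpa using this

theorem slice_subset_level {j : Fin (s + 1)} {d : ℕ} {A : Finset (Q q (s + 1))}
    (hA : A ⊆ level q (s + 1) d) (c : ℕ) : slice j c A ⊆ level q s (d - c) := by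
  intro h hh
  obtain ⟨x, hx, rfl, rfl⟩ := mem_slice.1 hh
  have e1 := deg_removeNth j x
  have e2 := mem_level.1 (hA hx)
  rw [mem_level]; omega

theorem IsSeg.slice {d : ℕ} {I : Finset (Q q (s + 1))} (hI : IsSeg d I) (j : Fin (s + 1))
    (c : ℕ) : IsSeg (d - c) (slice j c I) := by
  refine ⟨slice_subset_level hI.1 c, fun h hh g hg hlt => ?_⟩
  obtain ⟨x, hx, rfl, rfl⟩ := mem_slice.1 hh
  obtain ⟨y, hy, rfl⟩ := exists_removeNth_eq j (x j).2 g
  have e1 := deg_removeNth j x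
  have e2 := deg_removeNth j y
  have e3 := mem_level.1 (hI.1 hx)
  have e4 := mem_level.1 hg
  exact mem_slice.2 ⟨y, hI.2 x hx y (mem_level.2 (by omega))
    (toLex_lt_of_removeNth (Fin.ext hy) hlt), hy, rfl⟩

/-! ### Compression -/

/-- The position of a vector in the lexicographic order. -/
def lexRank (x : Q q s) : ℕ := (Finset.univ.filter fun y => LexLT y x).card

theorem lexRank_lt {x y : Q q s} (h : toLex x < toLex y) : lexRank x < lexRank y := by
  refine Finset.card_lt_card ⟨fun z hz => ?_, fun hc => ?_⟩
  · rw [Finset.mem_filter] at hz ⊢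
    exact ⟨hz.1, lt_trans (show toLex z < toLex x from hz.2) h⟩
  · have := (Finset.mem_filter.1 (hc (Finset.mem_filter.2 ⟨Finset.mem_univ x, h⟩))).2
    exact lt_irrefl (toLex x) this

/-- `I \ B` and `B \ I` have the same nonzero size, and every element of the former precedes every
element of the latter. -/
theorem IsSeg.sum_lt_sum {e : ℕ} {I B : Finset (Q q s)} (hI : IsSeg e I) (hB : B ⊆ level q s e)
    (hc : I.card = B.card) (hne : I ≠ B) {f : Q q s → ℕ}
    (hf : ∀ x y, toLex x < toLex y → f x < f y) : ∑ x ∈ I, f x < ∑ x ∈ B, f x := by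
  have hIB : (I \ B).Nonempty := by
    rw [Finset.nonempty_iff_ne_empty, Ne, Finset.sdiff_eq_empty_iff_subset]
    exact fun h => hne (Finset.eq_of_subset_of_card_le h hc.ge)
  have hcard : (I \ B).card = (B \ I).card := Finset.card_sdiff_comm hc
  have hlt : ∀ x ∈ B \ I, (I \ B).sup f + 1 ≤ f x := by
    intro x hx
    rw [Finset.mem_sdiff] at hx
    obtain ⟨y, hy, hyeq⟩ := Finset.exists_mem_eq_sup _ hIB f
    rw [Finset.mem_sdiff] at hy
    rw [hyeq]
    refine hf _ _ (lt_of_not_ge fun h => hx.2 (hI.mem_of_le hy.1 (mem_level.1 (hB hx.1)) h))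
  have h1 : ∑ x ∈ I \ B, f x ≤ (I \ B).card * (I \ B).sup f :=
    Finset.sum_le_card_nsmul _ _ _ fun x hx => Finset.le_sup hx
  have h2 : (B \ I).card * ((I \ B).sup f + 1) ≤ ∑ x ∈ B \ I, f x :=
    Finset.card_nsmul_le_sum _ _ _ hlt
  rw [← hcard, mul_add] at h2
  have h3 := Finset.card_pos.2 hIB
  rw [← Finset.sum_inter_add_sum_sdiff I B, ← Finset.sum_inter_add_sum_sdiff B I,
    Finset.inter_comm B I]
  omega

/-- `A` is compressed in every coordinate. -/
def Compressed (d : ℕ) (A : Finset (Q q (s + 1))) : Prop :=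
  ∀ j, ∀ x ∈ A, ∀ y ∈ level q (s + 1) d, y j = x j → toLex y < toLex x → y ∈ A

/-- Each slice along a violating coordinate is replaced by the segment of its size. The sum of ranks
drops, so compression terminates. -/
theorem exists_compression (H : ClementsLindstrom q s) {d : ℕ} {A : Finset (Q q (s + 1))}
    (hA : A ⊆ level q (s + 1) d) (hnot : ¬ Compressed d A) :
    ∃ C ⊆ level q (s + 1) d, C.card = A.card ∧ (bdry C).card ≤ (bdry A).card ∧
      ∑ x ∈ C, lexRank x < ∑ x ∈ A, lexRank x := by
  unfold Compressed at hnot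
  push Not at hnot
  obtain ⟨j, x, hx, y, hy, hyx, hlt, hyA⟩ := hnot
  choose I hI hIc using fun c => exists_isSeg (Finset.card_le_card (slice_subset_level (j := j) hA c))
  set C : Finset (Q q (s + 1)) := Finset.univ.filter fun z => j.removeNth z ∈ I (z j) with hC
  have hmemC : ∀ z, z ∈ C ↔ j.removeNth z ∈ I (z j) := fun z => by simp [hC]
  have hsl : ∀ c, slice j c C = I c := by
    intro c
    ext h
    rw [mem_slice]
    constructor
    · rintro ⟨z, hz, rfl, rfl⟩; exact (hmemC z).1 hz
    · intro hh
      have hne : (slice j c A).Nonempty := Finset.card_pos.1 (hIc c ▸ Finset.card_pos.2 ⟨h, hh⟩)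
      obtain ⟨g, hg⟩ := hne
      obtain ⟨w, hw, hwc, -⟩ := mem_slice.1 hg
      obtain ⟨z, hz, rfl⟩ := exists_removeNth_eq j (c := c) (hwc ▸ (w j).2) h
      exact ⟨z, (hmemC z).2 (by rwa [hz]), hz, rfl⟩
  refine ⟨C, fun z hz => ?_, ?_, ?_, ?_⟩
  · have h1 := (hmemC z).1 hz
    obtain ⟨g, hg⟩ : (slice j (z j) A).Nonempty :=
      Finset.card_pos.1 (hIc (z j) ▸ Finset.card_pos.2 ⟨_, h1⟩)
    obtain ⟨w, hw, hwc, -⟩ := mem_slice.1 hg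
    have e1 := mem_level.1 ((hI _).1 h1)
    have e2 := deg_removeNth j z
    have e3 := deg_removeNth j w
    have e4 := mem_level.1 (hA hw)
    rw [mem_level]; omega
  · rw [card_eq_sum_slice j C, card_eq_sum_slice j A]
    exact Finset.sum_congr rfl fun c _ => by rw [hsl, hIc]
  · rw [card_eq_sum_slice j (bdry C), card_eq_sum_slice j (bdry A)]
    refine Finset.sum_le_sum fun c _ => ?_
    rw [slice_bdry, slice_bdry, hsl, hsl]
    -- Both pieces of the slice of `bdry C` are segments of the same level, hence nested: their
    -- union is the larger one, and each is no larger than its counterpart for `A`.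
    have hs1 : IsSeg (d - c - 1) (I (c + 1)) := hI (c + 1)
    rcases le_total (bdry (I c)).card (I (c + 1)).card with h | h
    · rw [Finset.union_eq_right.2 ((hI c).bdry.subset_of_card_le hs1 h), hIc]
      exact Finset.card_le_card Finset.subset_union_right
    · rw [Finset.union_eq_left.2 (hs1.subset_of_card_le (hI c).bdry h)]
      exact (H _ _ _ (slice_subset_level hA c) (hI c) (hIc c).le).trans
        (Finset.card_le_card Finset.subset_union_left)
  -- The value `0` is never used: the sums only run over `c < q`.
  · let f : ℕ → Q q s → ℕ := fun c h =>
      if hc : c < q then lexRank (j.insertNth (α := fun _ => Fin q) ⟨c, hc⟩ h) else 0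
    have hf : ∀ z : Q q (s + 1), lexRank z = f (z j) (j.removeNth z) := fun z => by
      simp only [f, (z j).2, dif_pos, Fin.eta, Fin.insertNth_self_removeNth]
    have hfm : ∀ c < q, ∀ g h, toLex g < toLex h → f c g < f c h := by
      intro c hc g h hgh
      simp only [f, hc, dif_pos]
      exact lexRank_lt (toLex_lt_of_removeNth (j := j) (by simp) (by simpa using hgh))
    have hlt' : ∀ c < q, I c ≠ slice j c A →
        ∑ h ∈ I c, f c h < ∑ h ∈ slice j c A, f c h := fun c hc hne =>
      (hI c).sum_lt_sum (slice_subset_level hA c) (hIc c) hne (hfm c hc)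
    simp only [hf]
    rw [sum_eq_sum_slice, sum_eq_sum_slice]
    simp only [hsl]
    refine Finset.sum_lt_sum (fun c hc => ?_) ⟨x j, Finset.mem_range.2 (x j).2, ?_⟩
    · by_cases hne : I c = slice j c A
      · rw [hne]
      · exact (hlt' c (Finset.mem_range.1 hc) hne).le
    · refine hlt' _ (x j).2 fun heq => hyA ?_
      rw [← removeNth_mem_slice (j := j), hyx, ← heq]
      have e1 := deg_removeNth j x
      have e2 := deg_removeNth j y
      have e3 := mem_level.1 (hA hx)
      have e4 := mem_level.1 hy
      rw [hyx] at e2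
      refine (hI _).mem_of_le (heq ▸ removeNth_mem_slice.2 hx) (by omega) ?_
      by_contra hcon
      exact lt_asymm hlt (toLex_lt_of_removeNth hyx.symm (not_le.1 hcon))

theorem exists_compressed (H : ClementsLindstrom q s) {d : ℕ} {A : Finset (Q q (s + 1))}
    (hA : A ⊆ level q (s + 1) d) :
    ∃ C ⊆ level q (s + 1) d, C.card = A.card ∧ (bdry C).card ≤ (bdry A).card ∧
      Compressed d C := by
  induction hn : ∑ x ∈ A, lexRank x using Nat.strong_induction_on generalizing A with
  | _ n ih =>
    by_cases hcomp : Compressed d A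
    · exact ⟨A, hA, rfl, le_rfl, hcomp⟩
    · obtain ⟨B, hB, hBc, hBb, hlt⟩ := exists_compression H hA hcomp
      obtain ⟨C, hC, hCc, hCb, hcc⟩ := ih _ (hn ▸ hlt) hB rfl
      exact ⟨C, hC, hCc.trans hBc, hCb.trans hBb, hcc⟩

/-! ### Shifted sets and the induction on dimension -/

/-- `A` is closed under moving one unit to the last coordinate. -/
def Shifted (A : Finset (Q q (s + 1))) : Prop :=
  ∀ x ∈ A, ∀ y, (y (Fin.last s) : ℕ) = x (Fin.last s) + 1 →
    (Fin.last s).removeNth y ≤ (Fin.last s).removeNth x → deg y = deg x → y ∈ A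

theorem toLex_lt_of_shift {x y : Q q (s + 1)}
    (h : (y (Fin.last s) : ℕ) = x (Fin.last s) + 1)
    (hr : (Fin.last s).removeNth y ≤ (Fin.last s).removeNth x) (hd : deg y = deg x) :
    toLex y < toLex x := by
  refine toLex_lt_of_removeNth_last (lt_of_le_of_ne (Pi.toLex_monotone hr) fun he => ?_)
  have he' : (Fin.last s).removeNth y = (Fin.last s).removeNth x := he
  have e1 := deg_removeNth (Fin.last s) x
  have e2 := deg_removeNth (Fin.last s) y
  rw [he'] at e2
  omega

theorem IsSeg.shifted {d : ℕ} {I : Finset (Q q (s + 1))} (hI : IsSeg d I) : Shifted I :=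
  fun x hx y h hr hd => hI.2 x hx y
    (mem_level.2 (hd.trans (mem_level.1 (hI.1 hx)))) (toLex_lt_of_shift h hr hd)

theorem exists_eq_of_deg_succ (hs : 2 ≤ s) {u h : Q q s} (hle : u ≤ h)
    (hd : deg u + 1 = deg h) : ∃ i, u i = h i := by
  by_contra! hne
  have : ∑ i, ((u i : ℕ) + 1) ≤ deg h := Finset.sum_le_sum fun i _ =>
    Fin.lt_def.1 (lt_of_le_of_ne (hle i) (hne i))
  rw [Finset.sum_add_distrib] at this
  have h2 : ∑ i, (u i : ℕ) = deg u := rfl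
  simp at this
  omega

/-- The move changes only two of at least three coordinates; compression along an unchanged one
applies. -/
theorem Compressed.shifted (hs : 2 ≤ s) {d : ℕ} {A : Finset (Q q (s + 1))}
    (hA : A ⊆ level q (s + 1) d) (hc : Compressed d A) : Shifted A := by
  intro x hx y h hr hd
  have e1 := deg_removeNth (Fin.last s) x
  have e2 := deg_removeNth (Fin.last s) y
  obtain ⟨i, hi⟩ := exists_eq_of_deg_succ hs hr (by omega)
  exact hc ((Fin.last s).succAbove i) x hx y (mem_level.2 (hd.trans (mem_level.1 (hA hx)))) hi
    (toLex_lt_of_shift h hr hd)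

theorem Shifted.mem {A : Finset (Q q (s + 1))} (hA : Shifted A) (n : ℕ) :
    ∀ x ∈ A, ∀ y, (y (Fin.last s) : ℕ) = x (Fin.last s) + n →
      (Fin.last s).removeNth y ≤ (Fin.last s).removeNth x → deg y = deg x → y ∈ A := by
  induction n with
  | zero =>
    intro x hx y h hr hd
    have e1 := deg_removeNth (Fin.last s) x
    have e2 := deg_removeNth (Fin.last s) y
    rwa [eq_of_removeNth_eq (by omega) (eq_of_le_of_deg_le hr (by omega))]
  | succ n ih =>
    intro x hx y h hr hd
    have e1 := deg_removeNth (Fin.last s) x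
    have e2 := deg_removeNth (Fin.last s) y
    obtain ⟨z, hz1, hz2, hz3⟩ := exists_between hr
      (k := deg ((Fin.last s).removeNth x) - 1) (by omega) (by omega)
    obtain ⟨w, hw, rfl⟩ := exists_removeNth_eq (Fin.last s) (c := x (Fin.last s) + 1)
      (by have := (y (Fin.last s)).2; omega) z
    have e3 := deg_removeNth (Fin.last s) w
    exact ih w (hA x hx w hw hz2 (by omega)) y (by omega) hz1 (by omega)

theorem Shifted.shadowAt_slice_subset {d : ℕ} {A : Finset (Q q (s + 1))} (hA : Shifted A)
    (hAd : A ⊆ level q (s + 1) d) {c c' : ℕ} (hcc : c ≤ c') (hcd : c' ≤ d) (hcq : c' < q) :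
    shadowAt (d - c') (slice (Fin.last s) c A) ⊆ slice (Fin.last s) c' A := by
  intro g hg
  obtain ⟨hd, h, hh, hgh⟩ := mem_shadowAt.1 hg
  obtain ⟨x, hx, rfl, rfl⟩ := mem_slice.1 hh
  obtain ⟨y, rfl, rfl⟩ := exists_removeNth_eq (Fin.last s) hcq g
  have e1 := mem_level.1 (hAd hx)
  have e2 := deg_removeNth (Fin.last s) y
  exact removeNth_mem_slice.2 (hA.mem (y (Fin.last s) - x (Fin.last s)) x hx y (by omega) hgh
    (by omega))

theorem Shifted.bdry_slice_subset {A : Finset (Q q (s + 1))} (hA : Shifted A) {c : ℕ}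
    (hc : c + 1 < q) : bdry (slice (Fin.last s) c A) ⊆ slice (Fin.last s) (c + 1) A := by
  intro g hg
  obtain ⟨h, hh, hgh, hd⟩ := mem_bdry.1 hg
  obtain ⟨x, hx, rfl, rfl⟩ := mem_slice.1 hh
  obtain ⟨y, hy, rfl⟩ := exists_removeNth_eq (Fin.last s) hc g
  have e1 := deg_removeNth (Fin.last s) x
  have e2 := deg_removeNth (Fin.last s) y
  exact mem_slice.2 ⟨y, hA x hx y hy hgh (by omega), hy, rfl⟩

theorem slice_eq_empty {j : Fin (s + 1)} {c : ℕ} (hc : q ≤ c) (A : Finset (Q q (s + 1))) :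
    slice j c A = ∅ := by
  refine Finset.eq_empty_of_forall_notMem fun h hh => ?_
  obtain ⟨x, -, h1, -⟩ := mem_slice.1 hh
  have := (x j).2
  omega

/-- For `c < p`, slice `c` of the shadow is just slice `c + 1` of `A`, which absorbs the shadow of
slice `c`. Only the top slice contributes a genuine shadow. -/
theorem Shifted.card_bdry {p : ℕ} {A : Finset (Q (p + 1) (s + 1))} (hA : Shifted A) :
    (bdry A).card + (slice (Fin.last s) 0 A).card =
      A.card + (bdry (slice (Fin.last s) p A)).card := by
  rw [card_eq_sum_slice (Fin.last s) A, card_eq_sum_slice (Fin.last s) (bdry A),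
    Finset.sum_range_succ' (fun c => (slice (Fin.last s) c A).card), Finset.sum_range_succ,
    slice_bdry, slice_eq_empty le_rfl, Finset.union_empty,
    Finset.sum_congr rfl fun c hc => by
      rw [slice_bdry, Finset.union_eq_right.2 (hA.bdry_slice_subset
        (Nat.succ_lt_succ (Finset.mem_range.1 hc)))]]
  omega

/-- Everything in slice `c'` of `I` precedes or equals whatever slice `c` of `I` omits, and
shiftedness puts the shadow of slice `c` of `A` into slice `c'` of `A`. -/
theorem card_slice_le_of_lt (H : ClementsLindstrom q s) {d : ℕ} {A I : Finset (Q q (s + 1))}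
    (hA : Shifted A) (hAd : A ⊆ level q (s + 1) d) (hI : IsSeg d I) {c c' : ℕ} (hcc : c ≤ c')
    (hcq : c' < q) (hlt : (slice (Fin.last s) c I).card < (slice (Fin.last s) c A).card) :
    (slice (Fin.last s) c' I).card ≤ (slice (Fin.last s) c' A).card := by
  by_cases hcd : c' ≤ d
  · refine (H.card_le_shadowAt (e := d - c) (k := d - c') (by omega) (slice_subset_level hAd c) hlt
      (slice_subset_level hI.1 c') ?_).trans
      (Finset.card_le_card (hA.shadowAt_slice_subset hAd hcc hcd hcq))
    intro h hh hhI u hu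
    obtain ⟨x, hx, rfl, rfl⟩ := mem_slice.1 hu
    obtain ⟨z, rfl, rfl⟩ := exists_removeNth_eq (Fin.last s) (hcc.trans_lt hcq) h
    rw [removeNth_mem_slice] at hhI
    have e1 := deg_removeNth (Fin.last s) z
    have e2 := mem_level.1 hh
    by_contra hcon
    exact hhI (hI.2 x hx z (mem_level.2 (by omega)) (toLex_lt_of_removeNth_last (not_le.1 hcon)))
  · have : slice (Fin.last s) c' I = ∅ := by
      refine Finset.eq_empty_of_forall_notMem fun h hh => ?_
      obtain ⟨x, hx, rfl, rfl⟩ := mem_slice.1 hh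
      have e1 := deg_removeNth (Fin.last s) x
      have e2 := mem_level.1 (hI.1 hx)
      omega
    simp [this]

theorem clementsLindstrom_succ (hs : 2 ≤ s) (H : ClementsLindstrom q s) :
    ClementsLindstrom q (s + 1) := by
  refine clementsLindstrom_of_card_eq fun d A I hA hI hc => ?_
  cases q with
  | zero =>
    have : bdry I = ∅ := Finset.eq_empty_of_forall_notMem fun x _ => (x 0).elim0
    simp [this]
  | succ p =>
    obtain ⟨C, hC, hCc, hCb, hcomp⟩ := exists_compressed H hA
    refine le_trans ?_ hCb
    have hsh := hcomp.shifted hs hC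
    have hsum : ∑ c ∈ Finset.range (p + 1), (slice (Fin.last s) c I).card =
        ∑ c ∈ Finset.range (p + 1), (slice (Fin.last s) c C).card := by
      rw [← card_eq_sum_slice, ← card_eq_sum_slice, hCc, hc]
    -- By `Shifted.card_bdry`, it suffices that `I` has the smaller last slice and the larger slice
    -- at `0`. Since the slice sizes have equal sums, a failure of either would contradict
    -- `card_slice_le_of_lt`.
    have hlast : (slice (Fin.last s) p I).card ≤ (slice (Fin.last s) p C).card := by
      by_cases hex : ∃ c ≤ p, (slice (Fin.last s) c I).card < (slice (Fin.last s) c C).card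
      · obtain ⟨c, hcp, hlt⟩ := hex
        exact card_slice_le_of_lt H hsh hC hI hcp (Nat.lt_succ_self p) hlt
      · push Not at hex
        exact ((Finset.sum_eq_sum_iff_of_le fun c hcp =>
          hex c (Nat.lt_succ_iff.1 (Finset.mem_range.1 hcp))).1 hsum.symm p (by simp)).ge
    have hzero : (slice (Fin.last s) 0 C).card ≤ (slice (Fin.last s) 0 I).card := by
      by_contra! hlt
      exact (Finset.sum_lt_sum (fun c hcp => card_slice_le_of_lt H hsh hC hI (Nat.zero_le c)
        (Finset.mem_range.1 hcp) hlt) ⟨0, by simp, hlt⟩).ne hsum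
    have h1 := hsh.card_bdry
    have h2 := hI.shifted.card_bdry
    have h3 := H _ _ _ (slice_subset_level hC p) (hI.slice (Fin.last s) p) hlast
    omega

theorem clementsLindstrom (q s : ℕ) : ClementsLindstrom q s := by
  rcases Nat.lt_or_ge s 2 with hs | hs
  · exact clementsLindstrom_of_le_one (by omega)
  · induction s, hs using Nat.le_induction with
    | base => exact clementsLindstrom_two
    | succ n hn ih => exact clementsLindstrom_succ hn ih

/-! ### Bands of degrees -/

theorem mem_delta {A : Finset (Q q s)} {y : Q q s} : y ∈ delta A ↔ ∃ x ∈ A, y ≤ x := by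
  simp [delta, lowShadow, Pi.le_def]

theorem mem_nabla {A : Finset (Q q s)} {y : Q q s} : y ∈ nabla A ↔ ∃ x ∈ A, x ≤ y := by
  simp [nabla, upShadow, Pi.le_def]

theorem mem_F {a b : ℕ} {x : Q q s} : x ∈ F q s a b ↔ a ≤ deg x ∧ deg x ≤ b := by
  simp [F]

theorem L_subset_F (a b m : ℕ) : L q s a b m ⊆ F q s a b := Finset.filter_subset _ _

theorem card_eq_sum_filter_deg {n : ℕ} {A : Finset (Q q s)} (hA : ∀ x ∈ A, deg x < n) :
    A.card = ∑ d ∈ Finset.range n, (A.filter fun x => deg x = d).card :=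
  Finset.card_eq_sum_card_fiberwise fun x hx => Finset.mem_coe.2 (Finset.mem_range.2 (hA x hx))

theorem shadowAt_filter_subset_delta (A : Finset (Q q s)) (k d : ℕ) :
    shadowAt k ((delta A).filter fun x => deg x = d) ⊆ (delta A).filter fun x => deg x = k := by
  intro y hy
  obtain ⟨h1, x, hx, hyx⟩ := mem_shadowAt.1 hy
  obtain ⟨z, hz, hxz⟩ := mem_delta.1 (Finset.mem_filter.1 hx).1
  exact Finset.mem_filter.2 ⟨mem_delta.2 ⟨z, hz, hyx.trans hxz⟩, h1⟩

theorem subset_delta (A : Finset (Q q s)) : A ⊆ delta A :=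
  fun x hx => mem_delta.2 ⟨x, hx, le_rfl⟩

/-- A coordinatewise smaller vector is lexicographically no later. -/
theorem filter_delta_L {a b m d : ℕ} (hd : a ≤ d) :
    ((delta (L q s a b m)).filter fun x => deg x = d) =
      (L q s a b m).filter fun x => deg x = d := by
  refine Finset.Subset.antisymm (fun y hy => ?_)
    (Finset.filter_subset_filter _ (subset_delta _))
  obtain ⟨hy1, hy2⟩ := Finset.mem_filter.1 hy
  obtain ⟨x, hx, hyx⟩ := mem_delta.1 hy1
  have h1 := mem_F.1 (L_subset_F _ _ _ hx)
  have h2 := deg_mono hyx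
  exact Finset.mem_filter.2 ⟨mem_L_of_lex_le hx (mem_F.2 (by omega)) (Pi.toLex_monotone hyx), hy2⟩

theorem isSeg_filter_L {a b m d : ℕ} : IsSeg d ((L q s a b m).filter fun x => deg x = d) := by
  refine ⟨fun x hx => mem_level.2 (Finset.mem_filter.1 hx).2, fun x hx y hy hlt => ?_⟩
  obtain ⟨hx1, hx2⟩ := Finset.mem_filter.1 hx
  have hy := mem_level.1 hy
  have h1 := mem_F.1 (L_subset_F _ _ _ hx1)
  exact Finset.mem_filter.2 ⟨mem_L_of_lex_le hx1 (mem_F.2 (by omega)) hlt.le, hy⟩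

theorem filter_delta_L_subset {a b m k : ℕ} (hk : k ≤ a) :
    ((delta (L q s a b m)).filter fun x => deg x = k) ⊆
      shadowAt k ((L q s a b m).filter fun x => deg x = a) := by
  intro y hy
  obtain ⟨hy1, hy2⟩ := Finset.mem_filter.1 hy
  obtain ⟨x, hx, hyx⟩ := mem_delta.1 hy1
  have h1 := mem_F.1 (L_subset_F _ _ _ hx)
  obtain ⟨z, hz1, hz2, hz3⟩ := exists_between hyx (k := a) (by omega) h1.1
  exact mem_shadowAt.2 ⟨hy2, z, Finset.mem_filter.2 ⟨mem_L_of_lex_le hx (mem_F.2 (by omega))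
    (Pi.toLex_monotone hz2), hz3⟩, hz1⟩

theorem card_delta_L_le {a b : ℕ} (hab : a ≤ b) {A : Finset (Q q s)} (hA : A ⊆ F q s a b) :
    (delta (L q s a b A.card)).card ≤ (delta A).card := by
  set X := L q s a b A.card with hX
  have hXc : X.card = A.card := by
    rw [hX, card_L]; exact min_eq_left (Finset.card_le_card hA)
  have hdeg : ∀ B ⊆ F q s a b, ∀ x ∈ delta B, deg x < b + 1 := fun B hB x hx => by
    obtain ⟨z, hz, hxz⟩ := mem_delta.1 hx
    have h1 := mem_F.1 (hB hz)
    have h2 := deg_mono hxz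
    omega
  have hlow : ∀ B ⊆ F q s a b, ∀ d ∈ Finset.range a, (B.filter fun x => deg x = d).card = 0 :=
    fun B hB d hd => by
      rw [Finset.card_eq_zero, Finset.filter_eq_empty_iff]
      intro x hx
      have h1 := mem_F.1 (hB hx)
      have h2 := Finset.mem_range.1 hd
      omega
  have hcard : ∀ B ⊆ F q s a b,
      B.card = ∑ d ∈ Finset.Ico a (b + 1), (B.filter fun x => deg x = d).card := fun B hB => by
    rw [card_eq_sum_filter_deg fun x hx => hdeg B hB x (subset_delta B hx),
      ← Finset.sum_range_add_sum_Ico _ (show a ≤ b + 1 by omega),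
      Finset.sum_eq_zero (hlow B hB), zero_add]
  have hXF : X ⊆ F q s a b := L_subset_F _ _ _
  have hlevel : ∀ (B : Finset (Q q s)) d, (B.filter fun x => deg x = d) ⊆ level q s d :=
    fun B d x hx => mem_level.2 (Finset.mem_filter.1 hx).2
  have hupper : ∑ d ∈ Finset.Ico a (b + 1), (X.filter fun x => deg x = d).card ≤
      ∑ d ∈ Finset.Ico a (b + 1), ((delta A).filter fun x => deg x = d).card := by
    rw [← hcard X hXF, hXc, hcard A hA]
    exact Finset.sum_le_sum fun d _ => Finset.card_le_card
      (Finset.filter_subset_filter _ (subset_delta A))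
  -- Either `delta A` is strictly larger in some degree `d`, and its shadow from there covers degree
  -- `a`, or it is nowhere larger and `hupper` forces equality in every degree.
  have hbase : (X.filter fun x => deg x = a).card ≤
      ((delta A).filter fun x => deg x = a).card := by
    by_cases hex : ∃ d ∈ Finset.Ico a (b + 1), (X.filter fun x => deg x = d).card <
        ((delta A).filter fun x => deg x = d).card
    · obtain ⟨d, hd, hlt⟩ := hex
      rw [Finset.mem_Ico] at hd
      refine ((clementsLindstrom q s).card_le_shadowAt hd.1 (hlevel _ d) hlt (hlevel _ a) ?_).trans
        (Finset.card_le_card (shadowAt_filter_subset_delta A a d))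
      intro h hh hhX u hu
      have hh := mem_level.1 hh
      by_contra hcon
      exact hhX (Finset.mem_filter.2 ⟨mem_L_of_lex_le (Finset.mem_filter.1 hu).1
        (mem_F.2 (by omega)) (not_le.1 hcon).le, hh⟩)
    · push Not at hex
      exact ((Finset.sum_eq_sum_iff_of_le hex).1 (le_antisymm (Finset.sum_le_sum hex) hupper) a
        (by simp; omega)).ge
  rw [card_eq_sum_filter_deg (hdeg X hXF), card_eq_sum_filter_deg (hdeg A hA),
    ← Finset.sum_range_add_sum_Ico _ (show a ≤ b + 1 by omega),
    ← Finset.sum_range_add_sum_Ico _ (show a ≤ b + 1 by omega)]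
  refine add_le_add (Finset.sum_le_sum fun k hk => ?_) ?_
  · have hk := (Finset.mem_range.1 hk).le
    exact (Finset.card_le_card (filter_delta_L_subset hk)).trans
      (((clementsLindstrom q s).shadowAt hk (hlevel _ a) isSeg_filter_L hbase).trans
        (Finset.card_le_card (shadowAt_filter_subset_delta A k a)))
  · refine le_of_eq_of_le (Finset.sum_congr rfl fun d hd => ?_) hupper
    rw [filter_delta_L (Finset.mem_Ico.1 hd).1]

/-! ### Duality between the two shadows -/

/-- Reversing the order of the coordinates of the complement. -/
def flip : Q q s ≃ Q q s where
  toFun x i := (x i.rev).rev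
  invFun x i := (x i.rev).rev
  left_inv x := by funext i; simp
  right_inv x := by funext i; simp

theorem flip_apply (x : Q q s) (i : Fin s) : flip x i = (x i.rev).rev := rfl

theorem deg_flip (x : Q q s) : deg (flip x) + deg x = s * (q - 1) := by
  rw [← deg_compl x]
  congr 1
  exact Equiv.sum_comp Fin.revPerm fun i => ((x i).rev : ℕ)

theorem flip_le_flip {x y : Q q s} : flip x ≤ flip y ↔ y ≤ x := by
  simp only [Pi.le_def, flip_apply, Fin.rev_le_rev]
  exact ⟨fun h i => by simpa using h i.rev, fun h i => h _⟩

/-- Reversing the coordinates turns the last difference into the first; complementing turns larger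
into smaller. -/
theorem antiLexLT_iff {x y : Q q s} : AntiLexLT x y ↔ LexLT (flip x) (flip y) := by
  constructor
  · rintro ⟨l, h1, h2⟩
    exact ⟨l.rev, fun i hi => by rw [flip_apply, flip_apply, h1 _ (Fin.lt_rev_iff.1 hi)],
      by simpa [flip_apply] using h2⟩
  · rintro ⟨l, h1, h2⟩
    refine ⟨l.rev, fun i hi => ?_, by simpa [flip_apply] using h2⟩
    simpa [flip_apply] using h1 i.rev (Fin.rev_lt_iff.1 hi)

theorem flip_mem_F {a b : ℕ} (hab : a ≤ b) (hb : b ≤ s * (q - 1)) {x : Q q s} :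
    flip x ∈ F q s (s * (q - 1) - b) (s * (q - 1) - a) ↔ x ∈ F q s a b := by
  have := deg_flip x
  rw [mem_F, mem_F]; omega

theorem map_flip_F {a b : ℕ} (hab : a ≤ b) (hb : b ≤ s * (q - 1)) :
    (F q s a b).map flip.toEmbedding = F q s (s * (q - 1) - b) (s * (q - 1) - a) := by
  ext x
  rw [Finset.mem_map_equiv, ← flip_mem_F hab hb, Equiv.apply_symm_apply]

theorem map_flip_nabla (A : Finset (Q q s)) :
    (nabla A).map flip.toEmbedding = delta (A.map flip.toEmbedding) := by
  ext y
  rw [Finset.mem_map_equiv, mem_nabla, mem_delta]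
  simp only [Finset.mem_map, Equiv.coe_toEmbedding, exists_exists_and_eq_and]
  refine exists_congr fun x => and_congr_right fun _ => ?_
  rw [← flip_le_flip, Equiv.apply_symm_apply]

theorem map_flip_N {a b m : ℕ} (hab : a ≤ b) (hb : b ≤ s * (q - 1)) :
    (N q s a b m).map flip.toEmbedding = L q s (s * (q - 1) - b) (s * (q - 1) - a) m := by
  have hcount : ∀ x : Q q s, ((F q s a b).filter fun y => AntiLexLT y x).card =
      ((F q s (s * (q - 1) - b) (s * (q - 1) - a)).filter fun y => LexLT y (flip x)).card := by
    intro x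
    rw [← map_flip_F hab hb, Finset.filter_map, Finset.card_map]
    exact congrArg Finset.card (Finset.filter_congr fun y _ => antiLexLT_iff)
  ext y
  obtain ⟨x, rfl⟩ := flip.surjective y
  rw [Finset.mem_map_equiv, Equiv.symm_apply_apply, N, L, Finset.mem_filter, Finset.mem_filter,
    hcount, flip_mem_F hab hb]

end RMShadow

theorem mainTheorem3 (q s : ℕ) (hq : IsPrimePow q) (hs : 1 ≤ s) (a b m : ℕ)
    (hab : a ≤ b) (hb : b ≤ s * (q - 1))
    (A : Finset (RMShadow.Q q s)) (hA : A ⊆ RMShadow.F q s a b) (hm : A.card = m) :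
    (RMShadow.nabla (RMShadow.N q s a b m)).card ≤ (RMShadow.nabla A).card ∧
      (RMShadow.delta (RMShadow.L q s a b m)).card ≤ (RMShadow.delta A).card := by
  subst hm
  refine ⟨?_, RMShadow.card_delta_L_le hab hA⟩
  have hA' := Finset.map_subset_map (f := RMShadow.flip.toEmbedding).2 hA
  rw [RMShadow.map_flip_F hab hb] at hA'
  have h := RMShadow.card_delta_L_le (by omega) hA'
  rwa [Finset.card_map, ← RMShadow.map_flip_N hab hb, ← RMShadow.map_flip_nabla,
    ← RMShadow.map_flip_nabla, Finset.card_map, Finset.card_map] at h
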